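/- All graphs are finite and simple. For a graph $G$, let $\chi(G)$ be its chromatic number and $\alpha(G)$ its independence number. For integers $m,n\ge 0$ let $K^{m}_{m,n}$ be the graph obtained from the complete bipartite graph $K_{m,n}$ by making every two distinct vertices on the side of size $m$ adjacent. A graph $H$ is a minor of $G$, written $G\succeq_m H$, if a graph isomorphic to $H$ can be obtained from $G$ by deleting vertices or edges and contracting edges; equivalently, if there are pairwise disjoint nonempty vertex sets $(B_w)_{w\in V(H)}$ of $G$, each inducing a connected subgraph, such that $G$ has an edge between $B_w$ and $B_{w'}$ for every edge $ww'$ of $H$. Theorem. The following two statements are equivalent. (A) For every $n$-vertex graph $G$ with $\alpha(G)=2$ and every positive integer $\ell$ with $2\ell\le\lceil n/2\rceil$, we have $G\succeq_m K^{\ell}_{\ell,\lceil n/2\rceil-\ell}$. (B) For every graph $G$ with $\alpha(G)\le 2$ and every positive integer $\ell$ with $2\ell\le\chi(G)$, we have $G\succeq_m K^{\ell}_{\ell,\chi(G)-\ell}$. -/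

import Mathlib

universe u

namespace SimpleGraph

/-- `H` is a minor of `G`: there are pairwise disjoint vertex sets `B w` of `G`, one for each vertex
`w` of `H`, each inducing a (nonempty) connected subgraph of `G`, such that for every edge `w w'`
of `H` there is an edge of `G` between `B w` and `B w'`. Contracting each `B w` to a vertex
and deleting what is superfluous yields `H`. -/
def IsGraphMinor {W : Type*} {V : Type*} (H : SimpleGraph W) (G : SimpleGraph V) : Prop :=
  ∃ B : W → Set V,
    (∀ w, (G.induce (B w)).Connected) ∧
    (∀ w w', w ≠ w' → Disjoint (B w) (B w')) ∧
    (∀ w w', H.Adj w w' → ∃ x ∈ B w, ∃ y ∈ B w', G.Adj x y)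

/-- The graph `K^m_{m,n}`: the complete bipartite graph `K_{m,n}` together with all edges between
distinct vertices of the side of size `m`. -/
def cliqueBipartite (m n : ℕ) : SimpleGraph (Fin m ⊕ Fin n) :=
  completeBipartiteGraph (Fin m) (Fin n) ⊔
    (⊤ : SimpleGraph (Fin m)).map (Function.Embedding.inl : Fin m ↪ Fin m ⊕ Fin n)

/-- The `n`-vertex version: every finite graph `G` on `n` vertices with `α(G) = 2` has a
`K^ℓ_{ℓ,⌈n/2⌉-ℓ}` minor for every positive integer `ℓ` with `2ℓ ≤ ⌈n/2⌉`. -/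
def OrderVersion : Prop :=
  ∀ (V : Type u) [Fintype V] (G : SimpleGraph V), G.indepNum = 2 →
    ∀ ℓ : ℕ, 0 < ℓ → 2 * ℓ ≤ ⌈(Fintype.card V : ℚ) / 2⌉₊ →
      (cliqueBipartite ℓ (⌈(Fintype.card V : ℚ) / 2⌉₊ - ℓ)).IsGraphMinor G

/-- The chromatic-number version: every finite graph `G` with `α(G) ≤ 2` and `χ(G) = k` has a
`K^ℓ_{ℓ,k-ℓ}` minor for every positive integer `ℓ` with `2ℓ ≤ k`. -/
def ChromaticVersion : Prop :=
  ∀ (V : Type u) [Fintype V] (G : SimpleGraph V), G.indepNum ≤ 2 →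
    ∀ k : ℕ, G.chromaticNumber = (k : ℕ∞) →
      ∀ ℓ : ℕ, 0 < ℓ → 2 * ℓ ≤ k → (cliqueBipartite ℓ (k - ℓ)).IsGraphMinor G

end SimpleGraph

/-! (B) gives (A) because colour classes have at most two vertices: `χ(G) ≥ ⌈n/2⌉`, and a model may
always be shrunk.

For the converse let `χ(G) = k + 1`. If `n > 2k`, then `⌈n/2⌉ ≥ k + 1` and (A) applies directly.
Otherwise a Tutte-Berge argument in the complement (`exists_joined_family_of_not_colorable`) gives
vertex sets `S i`, pairwise completely joined in `G`, with `∑ ⌈|S i|/2⌉ > k`. By (A) each `G[S i]`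
has a model with `⌈|S i|/2⌉` branch sets, half of them dominating, and models of joined sets
combine.

The obstacle is rounding: two odd models together lack one dominating set. `IsBalanced` carries the
repair. Each odd model gives up one branch set and frees two vertices; two disjoint edges between
the freed pairs are then dominating branch sets replacing the two lost ones (`insert_edges`). -/

namespace SimpleGraph

/-! ### Operations on models with dominating branch sets -/

section Models

variable {V : Type*} {G : SimpleGraph V} {S T : Set V} {a b k m : ℕ}

/-- `G[S]` has a minor obtained from a complete graph on `k` vertices by deleting edges outside
a set of `a` dominating vertices. `F` is the family of branch sets and `A` that of the
dominating ones. -/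
def HasDominatingModel (G : SimpleGraph V) (S : Set V) (a k : ℕ) : Prop :=
  ∃ A F : Finset (Set V), A ⊆ F ∧ A.card = a ∧ F.card = k ∧
    (∀ X ∈ F, X ⊆ S ∧ (G.induce X).Connected) ∧
    (∀ X ∈ F, ∀ Y ∈ F, X ≠ Y → Disjoint X Y) ∧
    (∀ X ∈ A, ∀ Y ∈ F, X ≠ Y → ∃ x ∈ X, ∃ y ∈ Y, G.Adj x y)

lemma nonempty_of_connected_induce {X : Set V} (h : (G.induce X).Connected) : X.Nonempty :=
  Set.nonempty_coe_sort.1 h.nonempty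

namespace HasDominatingModel

lemma mono (h : G.HasDominatingModel S a k) (hST : S ⊆ T) : G.HasDominatingModel T a k := by
  obtain ⟨A, F, hAF, hA, hF, h1, h2, h3⟩ := h
  exact ⟨A, F, hAF, hA, hF, fun X hX => ⟨(h1 X hX).1.trans hST, (h1 X hX).2⟩, h2, h3⟩

lemma of_le (h : G.HasDominatingModel S a k) (hb : b ≤ a) (hm : m ≤ k) (hbm : b ≤ m) :
    G.HasDominatingModel S b m := by
  obtain ⟨A, F, hAF, rfl, rfl, h1, h2, h3⟩ := h
  obtain ⟨A', hA', rfl⟩ := Finset.exists_subset_card_eq hb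
  obtain ⟨F', hAF', hF', rfl⟩ := Finset.exists_subsuperset_card_eq (hA'.trans hAF) hbm hm
  exact ⟨A', F', hAF', rfl, rfl, fun X hX => h1 X (hF' hX),
    fun X hX Y hY => h2 X (hF' hX) Y (hF' hY), fun X hX Y hY => h3 X (hA' hX) Y (hF' hY)⟩

lemma zero : G.HasDominatingModel S 0 0 :=
  ⟨∅, ∅, by simp⟩

lemma join (hS : G.HasDominatingModel S a k) (hT : G.HasDominatingModel T b m)
    (hST : ∀ x ∈ S, ∀ y ∈ T, G.Adj x y) : G.HasDominatingModel (S ∪ T) (a + b) (k + m) := by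
  classical
  have hdis : ∀ X ⊆ S, ∀ Y ⊆ T, Disjoint X Y := fun X hX Y hY =>
    Set.disjoint_left.2 fun x hx hy => (hST x (hX hx) x (hY hy)).ne rfl
  obtain ⟨A, F, hAF, rfl, rfl, h1, h2, h3⟩ := hS
  obtain ⟨B, E, hBE, rfl, rfl, g1, g2, g3⟩ := hT
  have hadj : ∀ X ∈ F, ∀ Y ∈ E, ∃ x ∈ X, ∃ y ∈ Y, G.Adj x y := by
    intro X hX Y hY
    obtain ⟨x, hx⟩ := nonempty_of_connected_induce (h1 X hX).2
    obtain ⟨y, hy⟩ := nonempty_of_connected_induce (g1 Y hY).2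
    exact ⟨x, hx, y, hy, hST x ((h1 X hX).1 hx) y ((g1 Y hY).1 hy)⟩
  have hFE : Disjoint F E := Finset.disjoint_left.2 fun X hX hY => by
    obtain ⟨x, hx⟩ := nonempty_of_connected_induce (h1 X hX).2
    exact Set.disjoint_left.1 (hdis X (h1 X hX).1 X (g1 X hY).1) hx hx
  refine ⟨A ∪ B, F ∪ E, Finset.union_subset_union hAF hBE,
    Finset.card_union_of_disjoint (Finset.disjoint_of_subset_left hAF
      (Finset.disjoint_of_subset_right hBE hFE)),
    Finset.card_union_of_disjoint hFE, ?_, ?_, ?_⟩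
  · intro X hX
    rcases Finset.mem_union.1 hX with hX | hX
    · exact ⟨(h1 X hX).1.trans Set.subset_union_left, (h1 X hX).2⟩
    · exact ⟨(g1 X hX).1.trans Set.subset_union_right, (g1 X hX).2⟩
  · intro X hX Y hY hne
    rcases Finset.mem_union.1 hX with hX | hX <;> rcases Finset.mem_union.1 hY with hY | hY
    · exact h2 X hX Y hY hne
    · exact hdis X (h1 X hX).1 Y (g1 Y hY).1
    · exact (hdis Y (h1 Y hY).1 X (g1 X hX).1).symm
    · exact g2 X hX Y hY hne
  · intro X hX Y hY hne
    rcases Finset.mem_union.1 hX with hX | hX <;> rcases Finset.mem_union.1 hY with hY | hY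
    · exact h3 X hX Y hY hne
    · exact hadj X (hAF hX) Y hY
    · obtain ⟨y, hy, x, hx, h⟩ := hadj Y hY X (hBE hX)
      exact ⟨x, hx, y, hy, h.symm⟩
    · exact g3 X hX Y hY hne

lemma insert_dominating {Z : Set V} (hS : G.HasDominatingModel S a k)
    (hZ : (G.induce Z).Connected) (hSZ : Disjoint S Z) (hadj : ∀ y ∈ S, ∃ z ∈ Z, G.Adj z y) :
    G.HasDominatingModel (S ∪ Z) (a + 1) (k + 1) := by
  classical
  obtain ⟨A, F, hAF, rfl, rfl, h1, h2, h3⟩ := hS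
  have htouch : ∀ Y ∈ F, ∃ z ∈ Z, ∃ y ∈ Y, G.Adj z y := by
    intro Y hY
    obtain ⟨y, hy⟩ := nonempty_of_connected_induce (h1 Y hY).2
    obtain ⟨z, hz, h⟩ := hadj y ((h1 Y hY).1 hy)
    exact ⟨z, hz, y, hy, h⟩
  have hZF : Z ∉ F := fun h => by
    obtain ⟨z, hz⟩ := nonempty_of_connected_induce hZ
    exact Set.disjoint_left.1 hSZ ((h1 Z h).1 hz) hz
  refine ⟨insert Z A, insert Z F, Finset.insert_subset_insert _ hAF,
    Finset.card_insert_of_notMem fun h => hZF (hAF h), Finset.card_insert_of_notMem hZF, ?_, ?_, ?_⟩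
  · intro X hX
    rcases Finset.mem_insert.1 hX with rfl | hX
    · exact ⟨Set.subset_union_right, hZ⟩
    · exact ⟨(h1 X hX).1.trans Set.subset_union_left, (h1 X hX).2⟩
  · intro X hX Y hY hne
    rcases Finset.mem_insert.1 hX with rfl | hX' <;> rcases Finset.mem_insert.1 hY with rfl | hY'
    · exact absurd rfl hne
    · exact (hSZ.mono_left (h1 Y hY').1).symm
    · exact hSZ.mono_left (h1 X hX').1
    · exact h2 X hX' Y hY' hne
  · intro X hX Y hY hne
    rcases Finset.mem_insert.1 hX with rfl | hX' <;> rcases Finset.mem_insert.1 hY with rfl | hY'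
    · exact absurd rfl hne
    · exact htouch Y hY'
    · obtain ⟨z, hz, x, hx, h⟩ := htouch X (hAF hX')
      exact ⟨x, hx, z, hz, h.symm⟩
    · exact h3 X hX' Y hY' hne

end HasDominatingModel

lemma IsClique.hasDominatingModel {s : Finset V} (hs : G.IsClique s) :
    G.HasDominatingModel s s.card s.card := by
  classical
  have hcard : (s.image fun v => ({v} : Set V)).card = s.card :=
    Finset.card_image_of_injective _ Set.singleton_injective
  refine ⟨s.image fun v => {v}, s.image fun v => {v}, subset_rfl, hcard, hcard, ?_, ?_, ?_⟩
  · intro X hX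
    obtain ⟨v, hv, rfl⟩ := Finset.mem_image.1 hX
    refine ⟨by simpa using hv, ?_⟩
    have : Nonempty ({v} : Set V) := ⟨⟨v, rfl⟩⟩
    exact ⟨.of_subsingleton⟩
  · intro X hX Y hY hne
    obtain ⟨v, hv, rfl⟩ := Finset.mem_image.1 hX
    obtain ⟨w, hw, rfl⟩ := Finset.mem_image.1 hY
    exact Set.disjoint_singleton.2 fun h => hne (by rw [h])
  · intro X hX Y hY hne
    obtain ⟨v, hv, rfl⟩ := Finset.mem_image.1 hX
    obtain ⟨w, hw, rfl⟩ := Finset.mem_image.1 hY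
    exact ⟨v, rfl, w, rfl, hs hv hw fun h => hne (by rw [h])⟩

/-! ### Translation between dominating models and minors -/

lemma cliqueBipartite_adj_inl_inl {i j : Fin a} :
    (cliqueBipartite a b).Adj (.inl i) (.inl j) ↔ i ≠ j := by
  simp [cliqueBipartite]

lemma cliqueBipartite_adj_inl_inr {i : Fin a} {j : Fin b} :
    (cliqueBipartite a b).Adj (.inl i) (.inr j) := by
  simp [cliqueBipartite]

lemma cliqueBipartite_not_adj_inr_inr {i j : Fin b} :
    ¬ (cliqueBipartite a b).Adj (.inr i) (.inr j) := by
  simp [cliqueBipartite]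

lemma HasDominatingModel.isGraphMinor (h : G.HasDominatingModel S a k) :
    (cliqueBipartite a (k - a)).IsGraphMinor G := by
  classical
  obtain ⟨A, F, hAF, rfl, rfl, h1, h2, h3⟩ := h
  have hFA : (F \ A).card = F.card - A.card := Finset.card_sdiff_of_subset hAF
  let f : Fin A.card ⊕ Fin (F.card - A.card) → Set V :=
    Sum.elim (fun i => (A.equivFin.symm i : Set V))
      (fun j => ((F \ A).equivFinOfCardEq hFA).symm j)
  have fl : ∀ i, f (.inl i) ∈ A := fun i => (A.equivFin.symm i).2
  have fr : ∀ j, f (.inr j) ∈ F \ A := fun j => (((F \ A).equivFinOfCardEq hFA).symm j).2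
  have hfF : ∀ w, f w ∈ F := by
    rintro (i | j)
    · exact hAF (fl i)
    · exact (Finset.mem_sdiff.1 (fr j)).1
  have hinj : f.Injective := by
    rintro (i | i) (j | j) hij
    · exact congrArg _ (A.equivFin.symm.injective (Subtype.ext hij))
    · exact absurd (hij ▸ fl i) (Finset.mem_sdiff.1 (fr j)).2
    · exact absurd (hij ▸ fl j) (Finset.mem_sdiff.1 (fr i)).2
    · exact congrArg _ (((F \ A).equivFinOfCardEq hFA).symm.injective (Subtype.ext hij))
  refine ⟨f, fun w => (h1 _ (hfF w)).2,
    fun w w' hne => h2 _ (hfF w) _ (hfF w') (hinj.ne hne), ?_⟩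
  rintro (i | i) w' hadj
  · exact h3 _ (fl i) _ (hfF w') (hinj.ne hadj.ne)
  · rcases w' with j | j
    · obtain ⟨x, hx, y, hy, h⟩ := h3 _ (fl j) _ (hfF (.inr i)) (hinj.ne hadj.ne')
      exact ⟨y, hy, x, hx, h.symm⟩
    · exact absurd hadj cliqueBipartite_not_adj_inr_inr

lemma Embedding.connected_induce_image {W : Type*} {H : SimpleGraph W} (φ : H ↪g G) {X : Set W}
    (h : (H.induce X).Connected) : (G.induce (φ '' X)).Connected := by
  let f : H.induce X →g G.induce (φ '' X) :=
    ⟨fun x => ⟨φ x.1, x.1, x.2, rfl⟩, fun h => φ.map_adj_iff.2 h⟩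
  refine h.map f ?_
  rintro ⟨_, x, hx, rfl⟩
  exact ⟨⟨x, hx⟩, rfl⟩

lemma IsGraphMinor.hasDominatingModel {W : Type*} {H : SimpleGraph W}
    (h : (cliqueBipartite a b).IsGraphMinor H) (φ : H ↪g G) (hφ : ∀ x, φ x ∈ S) :
    G.HasDominatingModel S a (a + b) := by
  classical
  obtain ⟨B, hc, hd, hadj⟩ := h
  let f : Fin a ⊕ Fin b → Set V := fun w => φ '' B w
  have hfc : ∀ w, (G.induce (f w)).Connected := fun w => φ.connected_induce_image (hc w)
  have hfd : ∀ w w', w ≠ w' → Disjoint (f w) (f w') := fun w w' hne =>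
    (Set.disjoint_image_iff φ.injective).2 (hd w w' hne)
  have hinj : f.Injective := by
    intro w w' heq
    by_contra hne
    obtain ⟨x, hx⟩ := nonempty_of_connected_induce (hfc w)
    exact Set.disjoint_left.1 (hfd w w' hne) hx (heq ▸ hx)
  refine ⟨Finset.univ.image fun i => f (.inl i), Finset.univ.image f, ?_, ?_, ?_, ?_, ?_, ?_⟩
  · intro X hX
    obtain ⟨i, -, rfl⟩ := Finset.mem_image.1 hX
    exact Finset.mem_image_of_mem f (Finset.mem_univ _)
  · exact (Finset.card_image_of_injective _ (hinj.comp Sum.inl_injective)).trans (by simp)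
  · rw [Finset.card_image_of_injective _ hinj]
    simp
  · intro X hX
    obtain ⟨w, -, rfl⟩ := Finset.mem_image.1 hX
    exact ⟨Set.image_subset_iff.2 fun x _ => hφ x, hfc w⟩
  · intro X hX Y hY hne
    obtain ⟨w, -, rfl⟩ := Finset.mem_image.1 hX
    obtain ⟨w', -, rfl⟩ := Finset.mem_image.1 hY
    exact hfd w w' fun h => hne (by rw [h])
  · intro X hX Y hY hne
    obtain ⟨i, -, rfl⟩ := Finset.mem_image.1 hX
    obtain ⟨w, -, rfl⟩ := Finset.mem_image.1 hY
    have : (cliqueBipartite a b).Adj (.inl i) w := by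
      rcases w with j | j
      · exact cliqueBipartite_adj_inl_inl.2 fun h => hne (by rw [h])
      · exact cliqueBipartite_adj_inl_inr
    obtain ⟨x, hx, y, hy, h⟩ := hadj _ _ this
    exact ⟨φ x, ⟨x, hx, rfl⟩, φ y, ⟨y, hy, rfl⟩, φ.map_adj_iff.2 h⟩

/-! ### Balanced models and their joins -/

/-- `G[S]` has a model with `k` branch sets, half of them (rounded down) dominating. If `k` is odd,
then moreover either the half can be rounded up, or one branch set can be traded for two vertices
of `S` that the remaining ones avoid. -/
def IsBalanced (G : SimpleGraph V) (S : Set V) (k : ℕ) : Prop :=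
  G.HasDominatingModel S (k / 2) k ∧
    (Odd k → G.HasDominatingModel S (k / 2 + 1) k ∨
      ∃ u ∈ S, ∃ v ∈ S, u ≠ v ∧ G.HasDominatingModel (S \ {u, v}) (k / 2) (k - 1))

/-- In a complete join every edge `uv` across dominates: `v` sees all of `S` and `u` all of `T`. So
`{u, v}` and `{u', v'}` both serve as dominating branch sets. -/
lemma HasDominatingModel.insert_edges {u u' v v' : V}
    (hS : G.HasDominatingModel (S \ {u, u'}) a k) (hT : G.HasDominatingModel (T \ {v, v'}) b m)
    (hST : ∀ x ∈ S, ∀ y ∈ T, G.Adj x y) (hu : u ∈ S) (hu' : u' ∈ S) (huu' : u ≠ u')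
    (hv : v ∈ T) (hv' : v' ∈ T) (hvv' : v ≠ v') :
    G.HasDominatingModel (S ∪ T) (a + b + 1 + 1) (k + m + 1 + 1) := by
  have hne : ∀ x ∈ S, ∀ y ∈ T, x ≠ y := fun x hx y hy => (hST x hx y hy).ne
  have h := hS.join hT fun x hx y hy => hST x hx.1 y hy.1
  have h' := h.insert_dominating (induce_pair_connected_of_adj (hST u hu v hv)) ?_ ?_
  · refine (h'.insert_dominating (induce_pair_connected_of_adj (hST u' hu' v' hv')) ?_ ?_).mono ?_
    · rw [Set.disjoint_left]
      rintro x (⟨hx | hx⟩ | hx) hx' <;> simp at hx hx' <;> grind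
    · rintro x ((hx | hx) | hx | hx)
      · exact ⟨v', by simp, (hST x hx.1 v' hv').symm⟩
      · exact ⟨u', by simp, hST u' hu' x hx.1⟩
      · exact ⟨v', by simp, hx ▸ (hST u hu v' hv').symm⟩
      · exact ⟨u', by simp, hx ▸ (hST u' hu' v hv)⟩
    · intro x hx
      simp at hx ⊢
      grind
  · rw [Set.disjoint_left]
    rintro x (hx | hx) hx' <;> simp at hx hx' <;> grind
  · rintro x (hx | hx)
    · exact ⟨v, by simp, (hST x hx.1 v hv).symm⟩
    · exact ⟨u, by simp, hST u hu x hx.1⟩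

lemma IsBalanced.join_even_odd (hS : G.IsBalanced S k) (hT : G.IsBalanced T m)
    (hST : ∀ x ∈ S, ∀ y ∈ T, G.Adj x y) (hk : Even k) (hm : Odd m) :
    G.IsBalanced (S ∪ T) (k + m) := by
  obtain ⟨a, rfl⟩ := hk
  obtain ⟨b, rfl⟩ := hm
  refine ⟨(hS.1.join hT.1 hST).of_le (by omega) le_rfl (by omega), fun _ => ?_⟩
  rcases hT.2 ⟨b, rfl⟩ with h | ⟨u, hu, v, hv, huv, h⟩
  · exact .inl ((hS.1.join h hST).of_le (by omega) le_rfl (by omega))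
  · refine .inr ⟨u, .inr hu, v, .inr hv, huv, ?_⟩
    refine ((hS.1.join h fun x hx y hy => hST x hx y hy.1).mono ?_).of_le
      (by omega) (by omega) (by omega)
    rintro x (hx | hx)
    · refine ⟨.inl hx, ?_⟩
      rintro (rfl | rfl)
      · exact (hST x hx x hu).ne rfl
      · exact (hST x hx x hv).ne rfl
    · exact ⟨.inr hx.1, hx.2⟩

lemma IsBalanced.join (hS : G.IsBalanced S k) (hT : G.IsBalanced T m)
    (hST : ∀ x ∈ S, ∀ y ∈ T, G.Adj x y) : G.IsBalanced (S ∪ T) (k + m) := by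
  rcases Nat.even_or_odd k with hk | hk <;> rcases Nat.even_or_odd m with hm | hm
  · refine ⟨(hS.1.join hT.1 hST).of_le ?_ le_rfl (by omega), fun h => ?_⟩
    · obtain ⟨a, rfl⟩ := hk
      obtain ⟨b, rfl⟩ := hm
      omega
    · exact absurd (hk.add hm) (Nat.not_even_iff_odd.2 h)
  · exact hS.join_even_odd hT hST hk hm
  · rw [Set.union_comm, add_comm]
    exact hT.join_even_odd hS (fun x hx y hy => (hST y hy x hx).symm) hm hk
  -- Here `k + m` is even, so only the first clause is at stake; it needs one dominating set more
  -- than `k / 2 + m / 2`.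
  · refine ⟨?_, fun h => absurd (hk.add_odd hm) (Nat.not_even_iff_odd.2 h)⟩
    have hS2 := hS.2 hk
    have hT2 := hT.2 hm
    obtain ⟨a, rfl⟩ := hk
    obtain ⟨b, rfl⟩ := hm
    rcases hS2 with h | ⟨u, hu, u', hu', huu', h⟩
    · exact (h.join hT.1 hST).of_le (by omega) le_rfl (by omega)
    rcases hT2 with h' | ⟨v, hv, v', hv', hvv', h'⟩
    · exact (hS.1.join h' hST).of_le (by omega) le_rfl (by omega)
    · exact (h.insert_edges h' hST hu hu' huu' hv hv' hvv').of_le (by omega) (by omega) (by omega)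

lemma isBalanced_biUnion {ι : Type*} (s : Finset ι) (S : ι → Set V) (k : ι → ℕ)
    (hS : ∀ i ∈ s, G.IsBalanced (S i) (k i))
    (hadj : ∀ i ∈ s, ∀ j ∈ s, i ≠ j → ∀ x ∈ S i, ∀ y ∈ S j, G.Adj x y) :
    G.IsBalanced (⋃ i ∈ s, S i) (∑ i ∈ s, k i) := by
  classical
  induction s using Finset.induction_on with
  | empty => exact ⟨by simpa using HasDominatingModel.zero, by simp⟩
  | insert i s hi ih =>
    rw [Finset.set_biUnion_insert, Finset.sum_insert hi]
    refine (hS i (by simp)).join (ih (fun j hj => hS j (by simp [hj]))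
      fun j hj l hl => hadj j (by simp [hj]) l (by simp [hl])) fun x hx y hy => ?_
    obtain ⟨j, hj, hy⟩ := Set.mem_iUnion₂.1 hy
    exact hadj i (by simp) j (by simp [hj]) (fun h => hi (h ▸ hj)) x hx y hy

end Models

/-! ### Matchings in the complement and Tutte's theorem -/

/-- Each vertex is coloured by its matching edge, whose two ends are non-adjacent in `G`. -/
lemma Subgraph.IsPerfectMatching.colorable_compl {V : Type*} [Fintype V] {G : SimpleGraph V}
    {M : Gᶜ.Subgraph} (hM : M.IsPerfectMatching) : G.Colorable (Fintype.card V / 2) := by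
  classical
  choose f hf using fun v => (Subgraph.isPerfectMatching_iff.1 hM v).exists
  let C : G.Coloring M.spanningCoe.edgeSet := Coloring.mk (fun v => ⟨s(v, f v), hf v⟩) <| by
    intro v w hvw heq
    have h : s(v, f v) = s(w, f w) := congrArg Subtype.val heq
    rcases Sym2.eq_iff.1 h with ⟨h, -⟩ | ⟨-, h⟩
    · exact hvw.ne h
    · exact ((compl_adj _ _ _).1 (h ▸ (hf v).adj_sub)).2 hvw
  have hdeg := M.spanningCoe.sum_degrees_eq_twice_card_edges
  simp only [Subgraph.degree_spanningCoe,
    Subgraph.isPerfectMatching_iff_forall_degree.1 hM] at hdeg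
  have hcard : Fintype.card V / 2 = Fintype.card M.spanningCoe.edgeSet := by
    rw [← edgeFinset_card]
    simp at hdeg
    omega
  exact hcard ▸ C.colorable

lemma sum_ncard_supp {V : Type*} [Finite V] (G : SimpleGraph V) [Fintype G.ConnectedComponent] :
    ∑ c : G.ConnectedComponent, c.supp.ncard = Nat.card V := by
  classical
  have := Fintype.ofFinite V
  rw [Nat.card_eq_fintype_card, ← Finset.card_univ,
    Finset.card_eq_sum_card_fiberwise (f := G.connectedComponentMk) (t := Finset.univ) (by simp)]
  refine Finset.sum_congr rfl fun c _ => ?_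
  rw [← Set.ncard_coe_finset]
  congr
  ext
  simp

lemma two_mul_sum_half_ncard_supp {V : Type*} [Finite V] (G : SimpleGraph V)
    [Fintype G.ConnectedComponent] :
    2 * ∑ c : G.ConnectedComponent, (c.supp.ncard + 1) / 2 =
      Nat.card V + G.oddComponents.ncard := by
  classical
  have hodd : G.oddComponents.ncard =
      ∑ c : G.ConnectedComponent, if Odd c.supp.ncard then 1 else 0 := by
    rw [← Finset.card_filter, ← Set.ncard_coe_finset]
    congr
    ext
    simp
  rw [hodd, ← sum_ncard_supp G, ← Finset.sum_add_distrib, Finset.mul_sum]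
  refine Finset.sum_congr rfl fun c _ => ?_
  split_ifs with h
  · obtain ⟨a, ha⟩ := h
    omega
  · obtain ⟨a, ha⟩ := Nat.not_odd_iff_even.1 h
    omega

/-- A form of the Tutte–Berge formula for the complement of `G`. -/
lemma exists_joined_family_of_not_colorable {V : Type u} [Fintype V] (G : SimpleGraph V) {k : ℕ}
    (hG : ¬ G.Colorable k) (hk : Fintype.card V ≤ 2 * k) :
    ∃ (ι : Type u) (_ : Fintype ι) (S : ι → Set V),
      (∀ i j, i ≠ j → ∀ x ∈ S i, ∀ y ∈ S j, G.Adj x y) ∧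
      k < ∑ i, ((S i).ncard + 1) / 2 := by
  classical
  -- Padding the complement with `d = 2k - n` universal vertices makes a perfect matching yield a
  -- `k`-colouring of `G`.
  obtain ⟨d, hd⟩ := Nat.exists_eq_add_of_le hk
  let e : V ↪ V ⊕ Fin d := Function.Embedding.inl
  let H : SimpleGraph (V ⊕ Fin d) := (G.map e)ᶜ
  have hinr : ∀ i x, x ≠ Sum.inr i → H.Adj (.inr i) x := fun i x hx => by
    simp [H, e, hx.symm]
  have hcardW : Fintype.card (V ⊕ Fin d) = 2 * k := by simp [hd]
  have hnoPM : ¬ ∃ M : H.Subgraph, M.IsPerfectMatching := by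
    rintro ⟨M, hM⟩
    have h := hM.colorable_compl
    rw [hcardW, Nat.mul_div_cancel_left k two_pos] at h
    exact hG (h.of_hom (Embedding.map e G).toHom)
  rw [tutte] at hnoPM
  push Not at hnoPM
  obtain ⟨U, hU⟩ := hnoPM
  unfold IsTutteViolator at hU
  set D := (⊤ : H.Subgraph).deleteVerts U with hD
  have hverts : D.verts = Uᶜ := by ext; simp [hD]
  have hcard : U.ncard + Nat.card D.verts = 2 * k := by
    rw [Nat.card_coe_set_eq, hverts, Set.ncard_add_ncard_compl, Nat.card_eq_fintype_card, hcardW]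
  have hDadj : ∀ x y : D.verts, D.coe.Adj x y ↔ H.Adj x y := by
    rintro ⟨x, hx⟩ ⟨y, hy⟩
    simp [hD] at hx hy
    simp [hD, hx, hy]
  -- A universal vertex outside `U` would leave a single component, forcing `U = ∅` and that
  -- component odd, although the order is `2k`.
  have hUinr : ∀ i, Sum.inr i ∈ U := by
    by_contra! h
    obtain ⟨i, hi⟩ := h
    have hi' : Sum.inr i ∈ D.verts := by rw [hverts]; exact hi
    have hcon : ∀ x : D.verts,
        D.coe.connectedComponentMk x = D.coe.connectedComponentMk ⟨_, hi'⟩ := by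
      intro x
      by_cases hx : x = ⟨_, hi'⟩
      · rw [hx]
      · refine (ConnectedComponent.sound (Adj.reachable ?_)).symm
        exact (hDadj _ _).2 (hinr i x fun h => hx (Subtype.ext h))
    have hle : D.coe.oddComponents.ncard ≤ 1 := by
      rw [Set.ncard_le_one]
      intro c _ c' _
      induction c using ConnectedComponent.ind
      induction c' using ConnectedComponent.ind
      exact (hcon _).trans (hcon _).symm
    have h1 : D.coe.oddComponents.ncard = 1 := by omega
    have : Odd (Nat.card D.verts) := (odd_ncard_oddComponents D.coe).1 (by rw [h1]; exact odd_one)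
    obtain ⟨r, hr⟩ := this
    omega
  let S : D.coe.ConnectedComponent → Set V := fun c =>
    {v | ∃ h : Sum.inl v ∈ D.verts, D.coe.connectedComponentMk ⟨_, h⟩ = c}
  have hS : ∀ c, (S c).ncard = c.supp.ncard := by
    intro c
    rw [← Set.ncard_image_of_injective (S c) (Sum.inl_injective (β := Fin d)),
      ← Set.ncard_image_of_injective c.supp Subtype.val_injective]
    congr 1
    ext (v | i)
    · simp [S]
    · simp [hverts, hUinr i]
  refine ⟨D.coe.ConnectedComponent, Fintype.ofFinite _, S, ?_, ?_⟩
  · rintro c c' hne x ⟨hx, rfl⟩ y ⟨hy, rfl⟩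
    by_contra hxy
    refine hne (ConnectedComponent.sound (Adj.reachable ((hDadj _ _).2 ?_)))
    refine (compl_adj _ _ _).2 ⟨fun h => hne (congrArg _ (Subtype.ext h)), fun h => hxy ?_⟩
    exact (Embedding.map e G).map_adj_iff.1 h
  · simp only [hS]
    let _ := Fintype.ofFinite D.coe.ConnectedComponent
    -- Twice the sum is `|H - U|` plus the number of odd components, which exceeds `|H - U| + |U| =
    -- 2k`.
    have := two_mul_sum_half_ncard_supp D.coe
    omega

/-! ### Independence number and the two implications -/

lemma ceil_natCast_div_two (n : ℕ) : ⌈(n : ℚ) / 2⌉₊ = (n + 1) / 2 := by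
  refine eq_of_forall_ge_iff fun c => ?_
  rw [Nat.ceil_le, div_le_iff₀ two_pos]
  norm_cast
  omega

lemma card_le_mul_of_colorable {V : Type*} [Fintype V] {G : SimpleGraph V} {k a : ℕ}
    (hG : G.Colorable k) (ha : G.indepNum ≤ a) : Fintype.card V ≤ a * k := by
  classical
  obtain ⟨C⟩ := hG
  have := Finset.card_le_mul_card_image_of_maps_to (f := C) (s := Finset.univ)
    (t := Finset.univ) (by simp) a fun c _ => ?_
  · simpa using this
  · refine (IsIndepSet.card_le_indepNum (G := G) ?_).trans ha
    intro x hx y hy _ hxy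
    simp at hx hy
    exact C.valid hxy (hx.trans hy.symm)

lemma indepNum_induce_le {V : Type*} [Finite V] (G : SimpleGraph V) (S : Set V) :
    (G.induce S).indepNum ≤ G.indepNum := by
  classical
  have := Fintype.ofFinite V
  obtain ⟨s, hs⟩ := (G.induce S).exists_isNIndepSet_indepNum
  rw [← hs.card_eq, ← Finset.card_map (Function.Embedding.subtype _)]
  refine IsIndepSet.card_le_indepNum ?_
  simp only [Finset.coe_map, Function.Embedding.subtype_apply]
  rintro _ ⟨x, hx, rfl⟩ _ ⟨y, hy, rfl⟩ hne h
  exact hs.isIndepSet hx hy (fun h => hne (by rw [h])) h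

lemma isClique_of_indepNum_induce_le_one {V : Type*} [Finite V] {G : SimpleGraph V} {S : Set V}
    (h : (G.induce S).indepNum ≤ 1) : G.IsClique S := by
  classical
  intro x hx y hy hne
  by_contra hxy
  have hind : (G.induce S).IsIndepSet (({⟨x, hx⟩, ⟨y, hy⟩} : Finset S) : Set S) := by
    simp only [Finset.coe_pair]
    rintro _ (rfl | rfl) _ (rfl | rfl) hne' h
    · exact hne' rfl
    · exact hxy h
    · exact hxy h.symm
    · exact hne' rfl
  have := hind.card_le_indepNum
  rw [Finset.card_pair (by simpa using hne)] at this
  omega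

lemma OrderVersion.hasDominatingModel (hA : OrderVersion.{u}) {V : Type u} [Finite V]
    {G : SimpleGraph V} (hG : G.indepNum ≤ 2) (S : Set V) :
    G.HasDominatingModel S ((S.ncard + 1) / 2 / 2) ((S.ncard + 1) / 2) := by
  classical
  have := Fintype.ofFinite V
  have hle := (G.indepNum_induce_le S).trans hG
  obtain h1 | h2 : (G.induce S).indepNum ≤ 1 ∨ (G.induce S).indepNum = 2 := by omega
  · have h := IsClique.hasDominatingModel (G := G) (s := S.toFinset)
      (by simpa using isClique_of_indepNum_induce_le_one h1)
    rw [Set.coe_toFinset, ← Set.ncard_eq_toFinset_card'] at h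
    exact h.of_le (by omega) (by omega) (by omega)
  -- (A) requires `ℓ > 0`; when the half is `0`, at most one branch set is needed and a single
  -- vertex suffices.
  rcases Nat.eq_zero_or_pos ((S.ncard + 1) / 2 / 2) with h0 | hpos
  · rcases S.eq_empty_or_nonempty with rfl | ⟨v, hv⟩
    · simpa using HasDominatingModel.zero
    · have h := IsClique.hasDominatingModel (G := G) (s := {v}) (by simp)
      exact (h.mono (by simpa using hv)).of_le (by omega) (by simp; omega) (by omega)
  · have h := hA S (G.induce S) h2 _ hpos
    rw [ceil_natCast_div_two, ← Nat.card_eq_fintype_card, Nat.card_coe_set_eq] at h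
    have h := (h (by omega)).hasDominatingModel (Embedding.induce S) Subtype.property
    rwa [Nat.add_sub_cancel' (by omega)] at h

/-- Deleting any two vertices of `S` lowers `⌈|S|/2⌉` by exactly one, so (A) on the remainder gives
the trade. A singleton instead rounds up. -/
lemma OrderVersion.isBalanced (hA : OrderVersion.{u}) {V : Type u} [Finite V]
    {G : SimpleGraph V} (hG : G.indepNum ≤ 2) (S : Set V) :
    G.IsBalanced S ((S.ncard + 1) / 2) := by
  refine ⟨hA.hasDominatingModel hG S, fun hodd => ?_⟩
  rcases Nat.lt_or_ge 1 S.ncard with h1 | h1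
  · obtain ⟨u, v, hu, hv, huv⟩ := (Set.one_lt_ncard_iff).1 h1
    refine .inr ⟨u, hu, v, hv, huv, ?_⟩
    have h := hA.hasDominatingModel hG (S \ {u, v})
    have hc : (S \ {u, v}).ncard = S.ncard - 2 := by
      rw [Set.ncard_sdiff (by simp [Set.insert_subset_iff, hu, hv]), Set.ncard_pair huv]
    rw [hc] at h
    obtain ⟨r, hr⟩ := hodd
    exact h.of_le (by omega) (by omega) (by omega)
  · have : S.ncard ≠ 0 := fun h => by simp [h] at hodd
    obtain ⟨v, hv⟩ := Set.nonempty_of_ncard_ne_zero this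
    have h := IsClique.hasDominatingModel (G := G) (s := {v}) (by simp)
    exact .inl ((h.mono (by simpa using hv)).of_le (by simp; omega) (by simp; omega) (by omega))

lemma OrderVersion.hasDominatingModel_of_not_colorable (hA : OrderVersion.{u}) {V : Type u}
    [Fintype V] {G : SimpleGraph V} (hG : G.indepNum ≤ 2) {k : ℕ} (hk : ¬ G.Colorable k) :
    G.HasDominatingModel Set.univ ((k + 1) / 2) (k + 1) := by
  rcases Nat.lt_or_ge (2 * k) (Fintype.card V) with h | h
  · have hm := hA.hasDominatingModel hG Set.univ
    rw [Set.ncard_univ, Nat.card_eq_fintype_card] at hm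
    exact hm.of_le (by omega) (by omega) (by omega)
  · obtain ⟨ι, _, S, hS, hsum⟩ := G.exists_joined_family_of_not_colorable hk h
    have hm := isBalanced_biUnion Finset.univ S _ (fun i _ => hA.isBalanced hG (S i))
      fun i _ j _ => hS i j
    exact (hm.1.mono (Set.subset_univ _)).of_le (by omega) (by omega) (by omega)

theorem OrderVersion.chromaticVersion (hA : OrderVersion.{u}) : ChromaticVersion.{u} := by
  intro V _ G hG k hk ℓ hℓ hℓk
  obtain ⟨m, rfl⟩ : ∃ m, k = m + 1 := ⟨k - 1, by omega⟩
  have hcol : ¬ G.Colorable m := fun h => by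
    have := hk ▸ chromaticNumber_le_iff_colorable.2 h
    norm_cast at this
    omega
  exact ((hA.hasDominatingModel_of_not_colorable hG hcol).of_le
    (by omega) le_rfl (by omega)).isGraphMinor

theorem ChromaticVersion.orderVersion (hB : ChromaticVersion.{u}) : OrderVersion.{u} := by
  intro V _ G hG ℓ hℓ hℓn
  rw [ceil_natCast_div_two] at hℓn ⊢
  obtain ⟨k, hk⟩ := ENat.ne_top_iff_exists.1
    (chromaticNumber_ne_top_iff_exists.2 ⟨_, G.colorable_of_fintype⟩)
  have hn := card_le_mul_of_colorable (chromaticNumber_le_iff_colorable.1 hk.ge) hG.le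
  have h := hB V G hG.le k hk.symm ℓ hℓ (by omega)
  have hm := h.hasDominatingModel (S := Set.univ) Embedding.refl fun _ => Set.mem_univ _
  exact (hm.of_le le_rfl (by omega) (by omega)).isGraphMinor

end SimpleGraph

theorem mainTheorem3 :
    SimpleGraph.OrderVersion.{u} ↔ SimpleGraph.ChromaticVersion.{u} :=
  ⟨SimpleGraph.OrderVersion.chromaticVersion, SimpleGraph.ChromaticVersion.orderVersion⟩
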